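/- Let $s\ge 1$ be an integer or $s=\infty$. The $s$-binary rank of an $n\times m$ $(0,1)$-matrix $M$ is the minimal $d$ for which there are $d$ rectangles $I_k\times J_k$ ($I_k\subseteq[n]$, $J_k\subseteq[m]$), on each of which $M$ is constantly $1$, such that every $1$-entry of $M$ lies in at least one and at most $s$ of them. Write $\binom{d}{\le s}=\sum_{i=0}^{\min(s,d)}\binom{d}{i}$. A matrix is $\epsilon$-far from a property if more than an $\epsilon$-fraction of its entries must be modified to obtain a matrix with the property. An adaptive one-sided error tester for a property of $n\times m$ $(0,1)$-matrices, with parameter $\epsilon$, is a randomized algorithm that queries entries of an unknown matrix, where each query may depend on the answers to the previous ones, accepts every matrix with the property with probability $1$, and rejects every matrix that is $\epsilon$-far from the property with probability at least $2/3$. **Theorem.** There are adaptive one-sided error testers for the property "$s$-binary rank at most $d$" and for the property "$s$-binary rank exactly $d$" of $n\times m$ $(0,1)$-matrices, which make $\tilde O\left(\binom{d}{\le s}2^d/\epsilon\right)$ queries. That is, there are absolute constants $C>0$ and $k\in\mathbb N$ such that for all integers $d,n,m\ge 0$, all such $s$ and all $0<\epsilon<1$, each of the two properties has an adaptive one-sided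 error tester with parameter $\epsilon$ that, on every $n\times m$ $(0,1)$-matrix and for every outcome of its random choices, makes at most $C\,F\,(1+\log F)^k$ queries, where $F=\binom{d}{\le s}2^d/\epsilon$. -/

import Mathlib

/-- `I k ×ˢ J k`, `k < d`, are `d` rectangles (possibly empty, possibly repeated) that are
monochromatic of value `1` in the `(0,1)`-matrix `M`, and every `1`-entry of `M` lies in at least
one and in at most `s` of them. -/
structure IsRectCover {n m : ℕ} (s : ℕ∞) (M : Matrix (Fin n) (Fin m) Bool) {d : ℕ}
    (I : Fin d → Finset (Fin n)) (J : Fin d → Finset (Fin m)) : Prop where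
  mono : ∀ k, ∀ i ∈ I k, ∀ j ∈ J k, M i j = true
  one_le : ∀ i j, M i j = true → 1 ≤ (Finset.univ.filter fun k => i ∈ I k ∧ j ∈ J k).card
  le_mult : ∀ i j, M i j = true →
    ((Finset.univ.filter fun k => i ∈ I k ∧ j ∈ J k).card : ℕ∞) ≤ s

/-- The `s`-binary rank of a `(0,1)`-matrix: the minimal number of rectangles in a cover as above.
(`s = 1` is the binary rank and `s = ⊤` the Boolean rank. For `1 ≤ s` a cover always exists.) -/
noncomputable def sBinaryRank {n m : ℕ} (s : ℕ∞) (M : Matrix (Fin n) (Fin m) Bool) : ℕ :=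
  sInf {d : ℕ | ∃ (I : Fin d → Finset (Fin n)) (J : Fin d → Finset (Fin m)), IsRectCover s M I J}

/-- For `1 ≤ s` the minimum in the definition of the `s`-binary rank is attained. -/
theorem sBinaryRank_spec {n m : ℕ} {s : ℕ∞} (hs : 1 ≤ s) (M : Matrix (Fin n) (Fin m) Bool) :
    ∃ (I : Fin (sBinaryRank s M) → Finset (Fin n)) (J : Fin (sBinaryRank s M) → Finset (Fin m)),
      IsRectCover s M I J := by
  classical
  refine Nat.sInf_mem (s := {d : ℕ | ∃ (I : Fin d → Finset (Fin n)) (J : Fin d → Finset (Fin m)),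
    IsRectCover s M I J}) ⟨n * m, ?_⟩
  let e : Fin (n * m) ≃ Fin n × Fin m := finProdFinEquiv.symm
  have key : ∀ i j, M i j = true → (Finset.univ.filter fun k =>
      i ∈ (if M (e k).1 (e k).2 = true then {(e k).1} else (∅ : Finset (Fin n))) ∧
        j ∈ ({(e k).2} : Finset (Fin m))).card = 1 := by
    intro i j hij
    rw [Finset.card_eq_one]
    refine ⟨e.symm (i, j), ?_⟩
    ext k
    simp only [Finset.mem_filter, Finset.mem_univ, true_and, Finset.mem_singleton,
      Equiv.eq_symm_apply, Prod.ext_iff]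
    constructor
    · rintro ⟨h1, h2⟩
      split_ifs at h1 with h
      · exact ⟨(Finset.mem_singleton.1 h1).symm, h2.symm⟩
      · simp at h1
    · rintro ⟨h1, h2⟩
      simp [h1, h2, hij]
  refine ⟨fun k => if M (e k).1 (e k).2 = true then {(e k).1} else ∅, fun k => {(e k).2},
    ?_, ?_, ?_⟩
  · intro k i hi j hj
    by_cases h : M (e k).1 (e k).2 = true
    · simp only [h, if_true, Finset.mem_singleton] at hi hj
      rw [hi, hj, h]
    · simp [h] at hi
  · intro i j hij
    exact (key i j hij).ge
  · intro i j hij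
    rw [key i j hij]
    exact_mod_cast hs

/-- `∑_{i ≤ s} (d choose i)`; the terms with `i > d` vanish and are left out, which gives the
formula a meaning for `s = ⊤` too. -/
noncomputable def binomLE (d : ℕ) (s : ℕ∞) : ℕ :=
  open Classical in ∑ i ∈ (Finset.range (d + 1)).filter (fun i : ℕ => (i : ℕ∞) ≤ s), d.choose i

/-- For finite `s`, `binomLE d s` is the usual partial sum of binomial coefficients. -/
theorem binomLE_coe (d s : ℕ) : binomLE d (s : ℕ∞) = ∑ i ∈ Finset.range (s + 1), d.choose i := by
  classical
  unfold binomLE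
  apply Finset.sum_subset_zero_on_sdiff
  · intro i hi
    simp only [Finset.mem_filter, Finset.mem_range, Nat.cast_le] at hi ⊢
    omega
  · intro i hi
    simp only [Finset.mem_sdiff, Finset.mem_filter, Finset.mem_range, Nat.cast_le] at hi
    exact Nat.choose_eq_zero_of_lt (by omega)
  · intros; rfl

/-- A randomized adaptive query algorithm with query access to the entries of an unknown
`n × m` `(0,1)`-matrix: it may halt and accept (`true`) or reject (`false`), query an entry and
go on depending on the answer, or draw a uniformly random element of `{0, …, k}` and go on
depending on it. -/
inductive QueryAlg (n m : ℕ) : Type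
  | halt (accept : Bool) : QueryAlg n m
  | query (i : Fin n) (j : Fin m) (next : Bool → QueryAlg n m) : QueryAlg n m
  | draw (k : ℕ) (next : Fin (k + 1) → QueryAlg n m) : QueryAlg n m

namespace QueryAlg

/-- The distribution of the verdict (`true` = accept, `false` = reject) on the matrix `M`. -/
noncomputable def verdict {n m : ℕ} (M : Matrix (Fin n) (Fin m) Bool) : QueryAlg n m → PMF Bool
  | halt b => PMF.pure b
  | query i j next => verdict M (next (M i j))
  | draw k next => (PMF.uniformOfFintype (Fin (k + 1))).bind fun r => verdict M (next r)

/-- The largest number of queries made on the matrix `M`, over all outcomes of the random draws. -/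
def queries {n m : ℕ} (M : Matrix (Fin n) (Fin m) Bool) : QueryAlg n m → ℕ
  | halt _ => 0
  | query i j next => 1 + queries M (next (M i j))
  | draw _ next => Finset.univ.sup fun r => queries M (next r)

end QueryAlg

/-- `M` is `ε`-far from the property `P`: to turn `M` into a matrix with property `P` one has to
modify more than an `ε`-fraction of its entries. -/
def IsFar {n m : ℕ} (ε : ℝ) (P : Matrix (Fin n) (Fin m) Bool → Prop)
    (M : Matrix (Fin n) (Fin m) Bool) : Prop :=
  ∀ M', P M' → ε * ((n : ℝ) * (m : ℝ)) <
    ((Finset.univ.filter fun p : Fin n × Fin m => M p.1 p.2 ≠ M' p.1 p.2).card : ℝ)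

/-- `A` is a one-sided error tester for `P` with proximity parameter `ε`: it accepts every matrix
with property `P` with probability `1` and rejects every matrix that is `ε`-far from `P` with
probability at least `2/3`. -/
def IsOneSidedTester {n m : ℕ} (ε : ℝ) (P : Matrix (Fin n) (Fin m) Bool → Prop)
    (A : QueryAlg n m) : Prop :=
  (∀ M, P M → A.verdict M true = 1) ∧ (∀ M, IsFar ε P M → 2 / 3 ≤ A.verdict M false)

/-! ### Covers and the rank -/

section Rank

variable {n m : ℕ} {s : ℕ∞}

/-! Put `F = binomLE d s * 2 ^ d` and call a submatrix `M[X, Y]` reduced if its rows are distinct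
and its columns are distinct. Two facts carry the proof. Small size: in a cover by `d` rectangles,
label each row and each column by the set of rectangles meeting it. On a reduced submatrix of rank
at most `d` the labels are distinct, and a row label and a column label share at most `s` elements,
so Sgall's bound `card_mul_card_le_of_card_inter_le` gives `|X| |Y| ≤ F`
(`IsReducedOn.card_mul_card_le`). Growth: if a reduced `M[X, Y]` has rank at most `d`, copying its
rows and columns yields a matrix of rank at most `d`. If `M` is far, the two differ in more than an
`ε`-fraction of the entries, and each such `(x, y)` enlarges the reduced submatrix by `x`, by `y` or
by both (`IsReducedOn.exists_close`). The tester enlarges a reduced submatrix by random rows and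
columns and rejects once its rank exceeds `d`. The three kinds of extension cost different numbers
of queries; drawing each kind with probability inversely proportional to its cost makes the expected
gain in size at least `ε / 3` times the expected cost, whatever the shape of the submatrix. As the
size is `O(F)`, a budget of `O(F / ε)` suffices, without a logarithm (`acc_runTester_le`). Rank
exactly `d` reduces to rank at most `d`: in a large matrix, planting an identity matrix row by row
raises the rank to exactly `d` at the price of `d ^ 2` entries; a small matrix is read entirely. -/

theorem IsRectCover.apply_eq_true_iff {M : Matrix (Fin n) (Fin m) Bool} {d : ℕ}
    {I : Fin d → Finset (Fin n)} {J : Fin d → Finset (Fin m)} (h : IsRectCover s M I J)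
    (i : Fin n) (j : Fin m) : M i j = true ↔ ∃ k, i ∈ I k ∧ j ∈ J k := by
  constructor
  · intro hij
    obtain ⟨k, hk⟩ := Finset.card_pos.1 (h.one_le i j hij)
    exact ⟨k, (Finset.mem_filter.1 hk).2⟩
  · rintro ⟨k, hi, hj⟩
    exact h.mono k i hi j hj

theorem IsRectCover.card_le {M : Matrix (Fin n) (Fin m) Bool} {d : ℕ}
    {I : Fin d → Finset (Fin n)} {J : Fin d → Finset (Fin m)} (h : IsRectCover s M I J)
    (i : Fin n) (j : Fin m) :
    ((Finset.univ.filter fun k => i ∈ I k ∧ j ∈ J k).card : ℕ∞) ≤ s := by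
  by_cases hij : M i j = true
  · exact h.le_mult i j hij
  · have : (Finset.univ.filter fun k => i ∈ I k ∧ j ∈ J k) = ∅ :=
      Finset.filter_eq_empty_iff.2 fun k _ hk =>
        hij ((h.apply_eq_true_iff i j).2 ⟨k, hk⟩)
    simp [this]

theorem IsRectCover.rank_le {M : Matrix (Fin n) (Fin m) Bool} {d : ℕ}
    {I : Fin d → Finset (Fin n)} {J : Fin d → Finset (Fin m)} (h : IsRectCover s M I J) :
    sBinaryRank s M ≤ d :=
  Nat.sInf_le ⟨I, J, h⟩

/-- A cover can be enlarged by empty rectangles. -/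
theorem IsRectCover.succ {M : Matrix (Fin n) (Fin m) Bool} {d : ℕ}
    {I : Fin d → Finset (Fin n)} {J : Fin d → Finset (Fin m)} (h : IsRectCover s M I J) :
    IsRectCover s M (Fin.cons ∅ I : Fin (d + 1) → Finset (Fin n))
      (Fin.cons ∅ J : Fin (d + 1) → Finset (Fin m)) := by
  have key : ∀ i j, (Finset.univ.filter fun k =>
      i ∈ (Fin.cons ∅ I : Fin (d + 1) → Finset (Fin n)) k ∧
      j ∈ (Fin.cons ∅ J : Fin (d + 1) → Finset (Fin m)) k).card =
      (Finset.univ.filter fun k => i ∈ I k ∧ j ∈ J k).card := by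
    intro i j
    rw [Fin.card_filter_univ_succ]
    simp
  refine ⟨?_, ?_, ?_⟩
  · intro k
    refine Fin.cases ?_ (fun k => ?_) k
    · simp
    · simpa using h.mono k
  · intro i j hij
    rw [key]
    exact h.one_le i j hij
  · intro i j hij
    rw [key]
    exact h.le_mult i j hij

theorem exists_isRectCover_of_rank_le (hs : 1 ≤ s) {M : Matrix (Fin n) (Fin m) Bool} {d : ℕ}
    (h : sBinaryRank s M ≤ d) :
    ∃ (I : Fin d → Finset (Fin n)) (J : Fin d → Finset (Fin m)), IsRectCover s M I J := by
  induction d, h using Nat.le_induction with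
  | base => exact sBinaryRank_spec hs M
  | succ d _ ih =>
    obtain ⟨I, J, h⟩ := ih
    exact ⟨_, _, h.succ⟩

/-- The matrix with entries `M (f i) (g j)`, and `0` where `f i` or `g j` is undefined. -/
def pullback (f : Fin n → Option (Fin n)) (g : Fin m → Option (Fin m))
    (M : Matrix (Fin n) (Fin m) Bool) : Matrix (Fin n) (Fin m) Bool :=
  fun i j => match f i, g j with
    | some a, some b => M a b
    | _, _ => false

theorem pullback_eq_true_iff {f : Fin n → Option (Fin n)} {g : Fin m → Option (Fin m)}
    {M : Matrix (Fin n) (Fin m) Bool} {i : Fin n} {j : Fin m} :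
    pullback f g M i j = true ↔ ∃ a b, f i = some a ∧ g j = some b ∧ M a b = true := by
  unfold pullback
  cases f i <;> cases g j <;> simp

/-- Preimages of the rectangles form a cover with the same multiplicities. This serves both for
passing to a submatrix and for duplicating rows and columns. -/
theorem sBinaryRank_pullback_le (hs : 1 ≤ s) (f : Fin n → Option (Fin n))
    (g : Fin m → Option (Fin m)) (M : Matrix (Fin n) (Fin m) Bool) :
    sBinaryRank s (pullback f g M) ≤ sBinaryRank s M := by
  classical
  obtain ⟨I, J, h⟩ := sBinaryRank_spec hs M
  refine IsRectCover.rank_le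
    (I := fun k => Finset.univ.filter fun i => ∃ a ∈ I k, f i = some a)
    (J := fun k => Finset.univ.filter fun j => ∃ b ∈ J k, g j = some b) ⟨?_, ?_, ?_⟩
  · intro k i hi j hj
    simp only [Finset.mem_filter, Finset.mem_univ, true_and] at hi hj
    obtain ⟨a, ha, hfa⟩ := hi
    obtain ⟨b, hb, hgb⟩ := hj
    exact pullback_eq_true_iff.2 ⟨a, b, hfa, hgb, h.mono k a ha b hb⟩
  all_goals
    intro i j hij
    obtain ⟨a, b, hfa, hgb, hab⟩ := pullback_eq_true_iff.1 hij
    simp only [Finset.mem_filter, Finset.mem_univ, true_and, hfa, hgb, Option.some.injEq,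
      exists_eq_right']
  · exact h.one_le a b hab
  · exact h.le_mult a b hab

/-- Modifying one row increases the rank by at most one. -/
theorem sBinaryRank_le_succ_of_row (hs : 1 ≤ s) {M M' : Matrix (Fin n) (Fin m) Bool} (i₀ : Fin n)
    (hM : ∀ i, i ≠ i₀ → ∀ j, M' i j = M i j) : sBinaryRank s M' ≤ sBinaryRank s M + 1 := by
  classical
  obtain ⟨I, J, h⟩ := sBinaryRank_spec hs M
  -- Row `i₀` leaves all old rectangles and gets one of its own, so its `1`-entries have
  -- multiplicity exactly `1`.
  set I' : Fin (sBinaryRank s M + 1) → Finset (Fin n) :=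
    Fin.cons {i₀} fun k => (I k).erase i₀ with hI'
  set J' : Fin (sBinaryRank s M + 1) → Finset (Fin m) :=
    Fin.cons (Finset.univ.filter fun j => M' i₀ j = true) J with hJ'
  have key : ∀ i j, M' i j = true → (Finset.univ.filter fun k => i ∈ I' k ∧ j ∈ J' k).card =
      if i = i₀ then 1 else (Finset.univ.filter fun k => i ∈ I k ∧ j ∈ J k).card := by
    intro i j hij
    rw [Fin.card_filter_univ_succ]
    by_cases hi : i = i₀
    · subst hi
      simp [hI', hJ', hij]
    · simp [hI', hJ', hi]
  refine IsRectCover.rank_le (I := I') (J := J') ⟨?_, ?_, ?_⟩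
  · intro k
    refine Fin.cases ?_ (fun k => ?_) k
    · simp [hI', hJ']
    · intro i hi j hj
      simp only [hI', hJ', Fin.cons_succ, Finset.mem_erase] at hi hj
      rw [hM i hi.1]
      exact h.mono k i hi.2 j hj
  · intro i j hij
    rw [key i j hij]
    split_ifs with hi
    · exact le_rfl
    · exact h.one_le i j (by rwa [← hM i hi])
  · intro i j hij
    rw [key i j hij]
    split_ifs with hi
    · exact_mod_cast hs
    · exact h.le_mult i j (by rwa [← hM i hi])

theorem sBinaryRank_le_rows (hs : 1 ≤ s) (M : Matrix (Fin n) (Fin m) Bool) :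
    sBinaryRank s M ≤ n := by
  classical
  have key : ∀ i j, M i j = true → (Finset.univ.filter fun k : Fin n =>
      i ∈ ({k} : Finset (Fin n)) ∧ j ∈ Finset.univ.filter fun j => M k j = true).card = 1 := by
    intro i j hij
    rw [Finset.card_eq_one]
    refine ⟨i, ?_⟩
    ext k
    simp only [Finset.mem_filter, Finset.mem_univ, true_and, Finset.mem_singleton]
    exact ⟨fun h => h.1.symm, fun h => ⟨h.symm, h ▸ hij⟩⟩
  refine IsRectCover.rank_le (I := fun k => {k})
    (J := fun k => Finset.univ.filter fun j => M k j = true) ⟨?_, ?_, ?_⟩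
  · simp
  · intro i j hij
    exact (key i j hij).ge
  · intro i j hij
    rw [key i j hij]
    exact_mod_cast hs

theorem sBinaryRank_le_cols (hs : 1 ≤ s) (M : Matrix (Fin n) (Fin m) Bool) :
    sBinaryRank s M ≤ m := by
  classical
  have key : ∀ i j, M i j = true → (Finset.univ.filter fun k : Fin m =>
      (i ∈ Finset.univ.filter fun i => M i k = true) ∧ j ∈ ({k} : Finset (Fin m))).card = 1 := by
    intro i j hij
    rw [Finset.card_eq_one]
    refine ⟨j, ?_⟩
    ext k
    simp only [Finset.mem_filter, Finset.mem_univ, true_and, Finset.mem_singleton]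
    exact ⟨fun h => h.2.symm, fun h => ⟨h ▸ hij, h.symm⟩⟩
  refine IsRectCover.rank_le (J := fun k => {k})
    (I := fun k => Finset.univ.filter fun i => M i k = true) ⟨?_, ?_, ?_⟩
  · intro k i hi j hj
    simp only [Finset.mem_filter, Finset.mem_univ, true_and, Finset.mem_singleton] at hi hj
    rw [hj, hi]
  · intro i j hij
    exact (key i j hij).ge
  · intro i j hij
    rw [key i j hij]
    exact_mod_cast hs

/-- A matrix containing an identity matrix of order `d` has rank at least `d`. -/
theorem le_sBinaryRank_of_identity (hs : 1 ≤ s) {d : ℕ} (hn : d ≤ n) (hm : d ≤ m)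
    {M : Matrix (Fin n) (Fin m) Bool}
    (hM : ∀ i j : Fin d, M (Fin.castLE hn i) (Fin.castLE hm j) = decide (i = j)) :
    d ≤ sBinaryRank s M := by
  obtain ⟨I, J, h⟩ := sBinaryRank_spec hs M
  have hex : ∀ i : Fin d, ∃ k, Fin.castLE hn i ∈ I k ∧ Fin.castLE hm i ∈ J k := fun i =>
    (h.apply_eq_true_iff _ _).1 (by simp [hM])
  choose κ hκ using hex
  -- A rectangle containing two diagonal positions would also contain an off-diagonal `0`.
  have hinj : Function.Injective κ := by
    intro i j hij
    have := h.mono (κ i) _ (hκ i).1 _ (hij ▸ (hκ j).2)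
    simpa [hM] using this
  simpa using Fintype.card_le_of_injective κ hinj

/-- A matrix of rank at most `d` can be turned into a matrix of rank exactly `d` by modifying at
most `d ^ 2` entries, if it has at least `d` rows and columns. -/
theorem exists_sBinaryRank_eq (hs : 1 ≤ s) {d : ℕ} (hn : d ≤ n) (hm : d ≤ m)
    {M : Matrix (Fin n) (Fin m) Bool} (hM : sBinaryRank s M ≤ d) :
    ∃ M' : Matrix (Fin n) (Fin m) Bool, sBinaryRank s M' = d ∧
      (Finset.univ.filter fun p : Fin n × Fin m => M p.1 p.2 ≠ M' p.1 p.2).card ≤ d ^ 2 := by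
  classical
  -- `N t` carries the first `t` rows of the planted identity. Each step raises the rank by at most
  -- one, so the first `t` at which it reaches `d` gives rank exactly `d`.
  let N : ℕ → Matrix (Fin n) (Fin m) Bool := fun t i j =>
    if i.1 < t ∧ j.1 < d then decide (i.1 = j.1) else M i j
  have hstep : ∀ t, t < d → sBinaryRank s (N (t + 1)) ≤ sBinaryRank s (N t) + 1 := by
    intro t ht
    refine sBinaryRank_le_succ_of_row hs ⟨t, ht.trans_le hn⟩ fun i hi j => ?_
    have hi' : i.1 ≠ t := fun h => hi (Fin.ext h)
    have : i.1 < t + 1 ↔ i.1 < t := by omega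
    simp only [N, this]
  have hlast : d ≤ sBinaryRank s (N d) :=
    le_sBinaryRank_of_identity hs hn hm fun i j => by simp [N, Fin.ext_iff]
  have hex : ∃ t, d ≤ sBinaryRank s (N t) := ⟨d, hlast⟩
  have ht := Nat.find_spec hex
  have htd : Nat.find hex ≤ d := Nat.find_min' hex hlast
  refine ⟨N (Nat.find hex), le_antisymm ?_ ht, ?_⟩
  · rcases h0 : Nat.find hex with _ | t
    · have : N 0 = M := by
        funext i j
        simp [N]
      rwa [this]
    · have h1 : ¬ d ≤ sBinaryRank s (N t) := Nat.find_min hex (by omega)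
      have := hstep t (by omega)
      omega
  · have hsub : (Finset.univ.filter fun p : Fin n × Fin m =>
        M p.1 p.2 ≠ N (Nat.find hex) p.1 p.2) ⊆
        (Finset.univ.image (Fin.castLE hn)) ×ˢ (Finset.univ.image (Fin.castLE hm)) := by
      rintro ⟨i, j⟩ hp
      simp only [Finset.mem_filter, Finset.mem_univ, true_and, N] at hp
      split_ifs at hp with h
      · simp only [Finset.mem_product, Finset.mem_image, Finset.mem_univ, true_and]
        exact ⟨⟨⟨i, by omega⟩, rfl⟩, ⟨⟨j, by omega⟩, rfl⟩⟩
      · exact absurd rfl hp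
    refine (Finset.card_le_card hsub).trans ?_
    rw [Finset.card_product, sq]
    refine Nat.mul_le_mul ?_ ?_ <;>
      exact Finset.card_image_le.trans (by simp)

end Rank

/-! ### Pairs of families with small intersections -/

theorem card_filter_card_le (d : ℕ) (s : ℕ∞) :
    (Finset.univ.filter fun a : Finset (Fin d) => (a.card : ℕ∞) ≤ s).card = binomLE d s := by
  classical
  unfold binomLE
  rw [Finset.card_eq_sum_card_fiberwise (f := Finset.card)
    (t := (Finset.range (d + 1)).filter fun i : ℕ => (i : ℕ∞) ≤ s)]
  · refine Finset.sum_congr (by congr) fun i hi => ?_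
    have : ((Finset.univ.filter fun a : Finset (Fin d) => (a.card : ℕ∞) ≤ s).filter
        fun a => a.card = i) = Finset.powersetCard i Finset.univ := by
      ext a
      simp only [Finset.mem_filter, Finset.mem_univ, true_and, Finset.mem_powersetCard,
        Finset.subset_univ]
      exact ⟨fun h => h.2, fun h => ⟨h ▸ (Finset.mem_filter.1 hi).2, h⟩⟩
    rw [this, Finset.card_powersetCard, Finset.card_univ, Fintype.card_fin]
  · intro a ha
    simp only [Finset.coe_filter, Finset.mem_univ, true_and, Set.mem_ofPred_eq,
      Finset.mem_range] at ha ⊢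
    have := Finset.card_le_univ a
    rw [Fintype.card_fin] at this
    exact ⟨by omega, ha⟩

/-- Sgall's bound on pairs of families with restricted intersections. -/
theorem card_mul_card_le_of_card_inter_le {d : ℕ} {s : ℕ∞} {A B : Finset (Finset (Fin d))}
    (h : ∀ a ∈ A, ∀ b ∈ B, ((a ∩ b).card : ℕ∞) ≤ s) :
    A.card * B.card ≤ binomLE d s * 2 ^ d := by
  classical
  -- Down-closures only enlarge the families, and a set in both closures lies in some `a ∩ b`, hence
  -- has at most `s` elements. Down-sets are positively correlated (Harris–Kleitman), which gives
  -- the product bound.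
  let D : Finset (Finset (Fin d)) → Finset (Finset (Fin d)) := fun A =>
    Finset.univ.filter fun c => ∃ a ∈ A, c ⊆ a
  have hD : ∀ A, IsLowerSet (D A : Set (Finset (Fin d))) := by
    intro A c c' hc' hc
    simp only [D, Finset.coe_filter, Finset.mem_univ, true_and, Set.mem_ofPred_eq] at hc ⊢
    obtain ⟨a, ha, hca⟩ := hc
    exact ⟨a, ha, hc'.trans hca⟩
  have hle : ∀ A, A ⊆ D A := fun A a ha => Finset.mem_filter.2 ⟨Finset.mem_univ _, a, ha, le_rfl⟩
  calc A.card * B.card ≤ (D A).card * (D B).card :=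
        Nat.mul_le_mul (Finset.card_le_card (hle A)) (Finset.card_le_card (hle B))
    _ ≤ 2 ^ Fintype.card (Fin d) * (D A ∩ D B).card := (hD A).le_card_inter_finset (hD B)
    _ ≤ 2 ^ d * binomLE d s := by
        rw [Fintype.card_fin, ← card_filter_card_le]
        refine Nat.mul_le_mul le_rfl (Finset.card_le_card fun c hc => ?_)
        simp only [D, Finset.mem_inter, Finset.mem_filter, Finset.mem_univ, true_and] at hc ⊢
        obtain ⟨⟨a, ha, hca⟩, b, hb, hcb⟩ := hc
        refine le_trans ?_ (h a ha b hb)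
        exact_mod_cast Finset.card_le_card (Finset.subset_inter hca hcb)
    _ = binomLE d s * 2 ^ d := mul_comm _ _

/-! ### Submatrices without repeated rows and columns -/

section Reduced

variable {n m : ℕ} {s : ℕ∞}

/-- The rows, and the columns, of the submatrix `M[X, Y]` are pairwise distinct. -/
def IsReducedOn (M : Matrix (Fin n) (Fin m) Bool) (X : Finset (Fin n)) (Y : Finset (Fin m)) : Prop :=
  (∀ x ∈ X, ∀ x' ∈ X, (∀ y ∈ Y, M x y = M x' y) → x = x') ∧
    ∀ y ∈ Y, ∀ y' ∈ Y, (∀ x ∈ X, M x y = M x y') → y = y'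

/-- The matrix that agrees with `M` on `X ×ˢ Y` and is `0` elsewhere. -/
def mask (M : Matrix (Fin n) (Fin m) Bool) (X : Finset (Fin n)) (Y : Finset (Fin m)) :
    Matrix (Fin n) (Fin m) Bool :=
  pullback (fun i => if i ∈ X then some i else none) (fun j => if j ∈ Y then some j else none) M

theorem mask_apply {M : Matrix (Fin n) (Fin m) Bool} {X : Finset (Fin n)} {Y : Finset (Fin m)}
    {i : Fin n} {j : Fin m} (hi : i ∈ X) (hj : j ∈ Y) : mask M X Y i j = M i j := by
  simp [mask, pullback, hi, hj]

theorem mask_congr {M K : Matrix (Fin n) (Fin m) Bool} {X : Finset (Fin n)} {Y : Finset (Fin m)}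
    (h : ∀ i ∈ X, ∀ j ∈ Y, K i j = M i j) : mask K X Y = mask M X Y := by
  funext i j
  by_cases hi : i ∈ X <;> by_cases hj : j ∈ Y <;> simp [mask, pullback, hi, hj]
  exact h i hi j hj

theorem isReducedOn_congr {M K : Matrix (Fin n) (Fin m) Bool} {X : Finset (Fin n)}
    {Y : Finset (Fin m)} (h : ∀ i ∈ X, ∀ j ∈ Y, K i j = M i j) :
    IsReducedOn K X Y ↔ IsReducedOn M X Y := by
  unfold IsReducedOn
  refine and_congr ?_ ?_
  · refine forall₄_congr fun x hx x' hx' => ?_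
    refine imp_congr (forall₂_congr fun y hy => ?_) Iff.rfl
    rw [h x hx y hy, h x' hx' y hy]
  · refine forall₄_congr fun y hy y' hy' => ?_
    refine imp_congr (forall₂_congr fun x hx => ?_) Iff.rfl
    rw [h x hx y hy, h x hx y' hy']

theorem isReducedOn_singleton (M : Matrix (Fin n) (Fin m) Bool) (x : Fin n) (y : Fin m) :
    IsReducedOn M {x} {y} := by
  constructor <;> simp

theorem IsReducedOn.card_mul_card_le (hs : 1 ≤ s) {M : Matrix (Fin n) (Fin m) Bool}
    {X : Finset (Fin n)} {Y : Finset (Fin m)} (h : IsReducedOn M X Y) {d : ℕ}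
    (hd : sBinaryRank s (mask M X Y) ≤ d) : X.card * Y.card ≤ binomLE d s * 2 ^ d := by
  classical
  obtain ⟨I, J, hIJ⟩ := exists_isRectCover_of_rank_le hs hd
  let f : Fin n → Finset (Fin d) := fun i => Finset.univ.filter fun k => i ∈ I k
  let g : Fin m → Finset (Fin d) := fun j => Finset.univ.filter fun k => j ∈ J k
  have key : ∀ i ∈ X, ∀ j ∈ Y, (M i j = true ↔ (f i ∩ g j).Nonempty) := by
    intro i hi j hj
    rw [← mask_apply (M := M) hi hj, hIJ.apply_eq_true_iff]
    simp [f, g, Finset.Nonempty]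
  have hf : Set.InjOn f X := by
    intro x hx x' hx' hxx
    refine h.1 x hx x' hx' fun y hy => ?_
    rw [Bool.eq_iff_iff, key x hx y hy, key x' hx' y hy, hxx]
  have hg : Set.InjOn g Y := by
    intro y hy y' hy' hyy
    refine h.2 y hy y' hy' fun x hx => ?_
    rw [Bool.eq_iff_iff, key x hx y hy, key x hx y' hy', hyy]
  rw [← Finset.card_image_of_injOn hf, ← Finset.card_image_of_injOn hg]
  refine card_mul_card_le_of_card_inter_le fun a ha b hb => ?_
  obtain ⟨i, -, rfl⟩ := Finset.mem_image.1 ha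
  obtain ⟨j, -, rfl⟩ := Finset.mem_image.1 hb
  rw [← Finset.filter_and]
  exact hIJ.card_le i j

/-- Copying the rows and columns of a reduced submatrix `M[X, Y]` gives a matrix of no larger rank
that differs from `M` only at entries `(x, y)` for which `x`, or `y`, or both of them extend `X`,
`Y` to a larger reduced submatrix. -/
theorem IsReducedOn.exists_close (hs : 1 ≤ s) {M : Matrix (Fin n) (Fin m) Bool}
    {X : Finset (Fin n)} {Y : Finset (Fin m)} (h : IsReducedOn M X Y) :
    ∃ M' : Matrix (Fin n) (Fin m) Bool, sBinaryRank s M' ≤ sBinaryRank s (mask M X Y) ∧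
      ∀ x y, M x y ≠ M' x y →
        (x ∉ X ∧ IsReducedOn M (insert x X) Y) ∨ (y ∉ Y ∧ IsReducedOn M X (insert y Y)) ∨
          (x ∉ X ∧ y ∉ Y ∧ IsReducedOn M (insert x X) (insert y Y)) := by
  classical
  -- A row goes to its representative in `X` as seen from `Y`. If there is none, the row itself
  -- extends `X`, so the value chosen there is irrelevant.
  let f : Fin n → Option (Fin n) := fun x =>
    if hx : ∃ x' ∈ X, ∀ y ∈ Y, M x y = M x' y then some hx.choose else none
  let g : Fin m → Option (Fin m) := fun y =>
    if hy : ∃ y' ∈ Y, ∀ x ∈ X, M x y = M x y' then some hy.choose else none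
  refine ⟨pullback f g (mask M X Y), sBinaryRank_pullback_le hs _ _ _, fun x y hxy => ?_⟩
  by_cases hx : ∃ x' ∈ X, ∀ y ∈ Y, M x y = M x' y
  swap
  · have hxX : x ∉ X := fun hxX => hx ⟨x, hxX, fun _ _ => rfl⟩
    refine Or.inl ⟨hxX, ?_, ?_⟩
    · intro a ha b hb hab
      rcases Finset.mem_insert.1 ha with rfl | ha' <;> rcases Finset.mem_insert.1 hb with rfl | hb'
      · rfl
      · exact absurd ⟨b, hb', hab⟩ hx
      · exact absurd ⟨a, ha', fun y hy => (hab y hy).symm⟩ hx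
      · exact h.1 a ha' b hb' hab
    · intro a ha b hb hab
      exact h.2 a ha b hb fun x hx => hab x (Finset.mem_insert_of_mem hx)
  by_cases hy : ∃ y' ∈ Y, ∀ x ∈ X, M x y = M x y'
  swap
  · have hyY : y ∉ Y := fun hyY => hy ⟨y, hyY, fun _ _ => rfl⟩
    refine Or.inr (Or.inl ⟨hyY, ?_, ?_⟩)
    · intro a ha b hb hab
      exact h.1 a ha b hb fun y hy => hab y (Finset.mem_insert_of_mem hy)
    · intro a ha b hb hab
      rcases Finset.mem_insert.1 ha with rfl | ha' <;> rcases Finset.mem_insert.1 hb with rfl | hb'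
      · rfl
      · exact absurd ⟨b, hb', hab⟩ hy
      · exact absurd ⟨a, ha', fun y hy => (hab y hy).symm⟩ hy
      · exact h.2 a ha' b hb' hab
  obtain ⟨hx'X, hx'⟩ := hx.choose_spec
  obtain ⟨hy'Y, hy'⟩ := hy.choose_spec
  have hne : M x y ≠ M hx.choose hy.choose := by
    have : pullback f g (mask M X Y) x y = M hx.choose hy.choose := by
      rw [← mask_apply (M := M) hx'X hy'Y]
      simp only [pullback, f, g, dif_pos hx, dif_pos hy]
    rwa [this] at hxy
  generalize hx.choose = x' at *
  generalize hy.choose = y' at *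
  have hne' : M x y ≠ M x' y := by rwa [hy' x' hx'X]
  have hne'' : M x y ≠ M x y' := by rwa [hx' y' hy'Y]
  have hxX : x ∉ X := fun hxX => hne' (by rw [h.1 x hxX x' hx'X hx'])
  have hyY : y ∉ Y := fun hyY => hne'' (by rw [h.2 y hyY y' hy'Y hy'])
  -- On `Y`, row `x` agrees with `x'` alone among the rows of `X`, and column `y` separates these
  -- two; so `x` is new once `y` is added. Columns are symmetric.
  have hrow : ∀ b ∈ X, (∀ z ∈ insert y Y, M x z = M b z) → False := by
    intro b hb hab
    have : x' = b := h.1 x' hx'X b hb fun z hz => by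
      rw [← hx' z hz, hab z (Finset.mem_insert_of_mem hz)]
    exact hne' (this ▸ hab y (Finset.mem_insert_self _ _))
  have hcol : ∀ b ∈ Y, (∀ z ∈ insert x X, M z y = M z b) → False := by
    intro b hb hab
    have : y' = b := h.2 y' hy'Y b hb fun z hz => by
      rw [← hy' z hz, hab z (Finset.mem_insert_of_mem hz)]
    exact hne'' (this ▸ hab x (Finset.mem_insert_self _ _))
  refine Or.inr (Or.inr ⟨hxX, hyY, ?_, ?_⟩)
  · intro a ha b hb hab
    rcases Finset.mem_insert.1 ha with rfl | ha' <;> rcases Finset.mem_insert.1 hb with rfl | hb'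
    · rfl
    · exact (hrow b hb' hab).elim
    · exact (hrow a ha' fun z hz => (hab z hz).symm).elim
    · exact h.1 a ha' b hb' fun z hz => hab z (Finset.mem_insert_of_mem hz)
  · intro a ha b hb hab
    rcases Finset.mem_insert.1 ha with rfl | ha' <;> rcases Finset.mem_insert.1 hb with rfl | hb'
    · rfl
    · exact (hcol b hb' hab).elim
    · exact (hcol a ha' fun z hz => (hab z hz).symm).elim
    · exact h.2 a ha' b hb' fun z hz => hab z (Finset.mem_insert_of_mem hz)

end Reduced

/-! ### Query algorithms -/

namespace QueryAlg

variable {n m : ℕ}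

/-- The probability that the algorithm accepts `M`. -/
noncomputable def acc (M : Matrix (Fin n) (Fin m) Bool) (A : QueryAlg n m) : ℝ :=
  (A.verdict M true).toReal

theorem verdict_true_eq_one_of_acc {M : Matrix (Fin n) (Fin m) Bool} {A : QueryAlg n m}
    (h : A.acc M = 1) : A.verdict M true = 1 := by
  rw [← ENNReal.ofReal_toReal (PMF.apply_ne_top (A.verdict M) true)]
  simp only [acc] at h
  rw [h, ENNReal.ofReal_one]

theorem verdict_false_ge_of_acc {M : Matrix (Fin n) (Fin m) Bool} {A : QueryAlg n m}
    (h : A.acc M ≤ 1 / 3) : 2 / 3 ≤ A.verdict M false := by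
  have h1 := (A.verdict M).tsum_coe
  rw [tsum_bool] at h1
  have h2 : (A.verdict M false).toReal + A.acc M = 1 := by
    rw [acc, ← ENNReal.toReal_add (PMF.apply_ne_top _ _) (PMF.apply_ne_top _ _), h1,
      ENNReal.toReal_one]
  rw [← ENNReal.toReal_le_toReal (by finiteness) (PMF.apply_ne_top _ _), ENNReal.toReal_div]
  simp only [ENNReal.toReal_ofNat]
  linarith

@[simp] theorem acc_halt_true (M : Matrix (Fin n) (Fin m) Bool) :
    (halt true : QueryAlg n m).acc M = 1 := by
  simp [acc, verdict]

@[simp] theorem acc_halt_false (M : Matrix (Fin n) (Fin m) Bool) :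
    (halt false : QueryAlg n m).acc M = 0 := by
  simp [acc, verdict]

theorem acc_query (M : Matrix (Fin n) (Fin m) Bool) (i : Fin n) (j : Fin m)
    (next : Bool → QueryAlg n m) : (query i j next).acc M = (next (M i j)).acc M := rfl

theorem acc_draw (M : Matrix (Fin n) (Fin m) Bool) (k : ℕ) (next : Fin (k + 1) → QueryAlg n m) :
    (draw k next).acc M = (∑ r, (next r).acc M) / (k + 1) := by
  simp only [acc, verdict, PMF.bind_apply, PMF.uniformOfFintype_apply, Fintype.card_fin]
  rw [tsum_fintype, ENNReal.toReal_sum]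
  · simp only [ENNReal.toReal_mul, ENNReal.toReal_inv, ENNReal.toReal_natCast]
    rw [← Finset.mul_sum]
    push_cast
    rw [inv_mul_eq_div]
  · intro r _
    exact ENNReal.mul_ne_top (by simp) (PMF.apply_ne_top _ _)

theorem acc_draw_eq_one {M : Matrix (Fin n) (Fin m) Bool} {k : ℕ}
    {next : Fin (k + 1) → QueryAlg n m} (h : ∀ r, (next r).acc M = 1) :
    (draw k next).acc M = 1 := by
  rw [acc_draw]
  simp only [h, Finset.sum_const, Finset.card_univ, Fintype.card_fin, nsmul_eq_mul, mul_one]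
  push_cast
  exact div_self (by positivity)

theorem queries_draw_le {M : Matrix (Fin n) (Fin m) Bool} {k : ℕ}
    {next : Fin (k + 1) → QueryAlg n m} {q : ℕ} (h : ∀ r, (next r).queries M ≤ q) :
    (draw k next).queries M ≤ q :=
  Finset.sup_le fun r _ => h r

/-- Set the entry of `K` at `p` to `b`. -/
def record (K : Matrix (Fin n) (Fin m) Bool) (p : Fin n × Fin m) (b : Bool) :
    Matrix (Fin n) (Fin m) Bool :=
  fun i j => if (i, j) = p then b else K i j

/-- Query all entries in the list and record the answers in the matrix `K`, the state of
knowledge about the unknown matrix. -/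
def learn : List (Fin n × Fin m) → Matrix (Fin n) (Fin m) Bool →
    (Matrix (Fin n) (Fin m) Bool → QueryAlg n m) → QueryAlg n m
  | [], K, next => next K
  | p :: l, K, next =>
    query p.1 p.2 fun b => learn l (record K p b) next

/-- The state of knowledge after querying the entries in a list. -/
def learned (M : Matrix (Fin n) (Fin m) Bool) (l : List (Fin n × Fin m))
    (K : Matrix (Fin n) (Fin m) Bool) : Matrix (Fin n) (Fin m) Bool :=
  fun i j => if (i, j) ∈ l then M i j else K i j

theorem learned_nil (M K : Matrix (Fin n) (Fin m) Bool) : learned M [] K = K := by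
  funext i j
  simp [learned]

theorem learned_cons (M : Matrix (Fin n) (Fin m) Bool) (p : Fin n × Fin m)
    (l : List (Fin n × Fin m)) (K : Matrix (Fin n) (Fin m) Bool) :
    learned M l (record K p (M p.1 p.2)) = learned M (p :: l) K := by
  funext i j
  simp only [learned, record, List.mem_cons]
  by_cases h1 : (i, j) ∈ l
  · simp [h1]
  · by_cases h2 : (i, j) = p
    · subst h2
      simp
    · simp [h1, h2]

theorem acc_learn (M : Matrix (Fin n) (Fin m) Bool) (l : List (Fin n × Fin m))
    (K : Matrix (Fin n) (Fin m) Bool) (next : Matrix (Fin n) (Fin m) Bool → QueryAlg n m) :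
    (learn l K next).acc M = (next (learned M l K)).acc M := by
  induction l generalizing K with
  | nil => simp [learn, learned_nil]
  | cons p l ih => rw [learn, acc_query, ih, learned_cons]

theorem queries_learn (M : Matrix (Fin n) (Fin m) Bool) (l : List (Fin n × Fin m))
    (K : Matrix (Fin n) (Fin m) Bool) (next : Matrix (Fin n) (Fin m) Bool → QueryAlg n m) :
    (learn l K next).queries M = l.length + (next (learned M l K)).queries M := by
  induction l generalizing K with
  | nil => simp [learn, learned_nil]
  | cons p l ih =>
    rw [learn, queries, ih, learned_cons, List.length_cons]
    ring

/-- The entries of `X' ×ˢ Y'` that are not in `X ×ˢ Y`. -/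
noncomputable def newEntries (X X' : Finset (Fin n)) (Y Y' : Finset (Fin m)) :
    List (Fin n × Fin m) :=
  ((X' ×ˢ Y') \ (X ×ˢ Y)).toList

theorem length_newEntries_add {X X' : Finset (Fin n)} {Y Y' : Finset (Fin m)} (hX : X ⊆ X')
    (hY : Y ⊆ Y') :
    (newEntries X X' Y Y').length + X.card * Y.card = X'.card * Y'.card := by
  rw [newEntries, Finset.length_toList, ← Finset.card_product, ← Finset.card_product,
    Finset.card_sdiff_add_card_eq_card (Finset.product_subset_product hX hY)]

theorem learned_newEntries {M K : Matrix (Fin n) (Fin m) Bool} {X X' : Finset (Fin n)}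
    {Y Y' : Finset (Fin m)} (hK : ∀ i ∈ X, ∀ j ∈ Y, K i j = M i j) :
    ∀ i ∈ X', ∀ j ∈ Y', learned M (newEntries X X' Y Y') K i j = M i j := by
  intro i hi j hj
  unfold learned
  split_ifs with h
  · rfl
  · simp only [newEntries, Finset.mem_toList, Finset.mem_sdiff, Finset.mem_product, hi, hj,
      true_and, and_self, not_not] at h
    exact hK i h.1 j h.2

end QueryAlg

/-! ### The tester for rank at most `d` -/

/-- The three ways of extending a submatrix. -/
inductive Extension
  | row | col | both

namespace Extension

variable {n m : ℕ}

/-- The rows after the extension. -/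
def rows (t : Extension) (X : Finset (Fin n)) (x : Fin n) : Finset (Fin n) :=
  match t with
  | row => insert x X
  | col => X
  | both => insert x X

/-- The columns after the extension. -/
def cols (t : Extension) (Y : Finset (Fin m)) (y : Fin m) : Finset (Fin m) :=
  match t with
  | row => Y
  | col => insert y Y
  | both => insert y Y

/-- The number of entries added to an `a × b` submatrix. -/
def cost (t : Extension) (a b : ℕ) : ℕ :=
  match t with
  | row => b
  | col => a
  | both => a + b + 1

/-- The sum of the weights. -/
def weight (a b : ℕ) : ℕ := a * (a + b + 1) + b * (a + b + 1) + a * b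

/-- The extension selected by the number `r < weight a b`: its probability is inversely
proportional to its cost. -/
def ofNat (a b r : ℕ) : Extension :=
  if r < a * (a + b + 1) then row
  else if r < a * (a + b + 1) + b * (a + b + 1) then col
  else both

/-- For each of the three kinds, weight times cost equals `a * b * (a + b + 1)`, so all contribute
equally to the expected cost. -/
theorem sum_ofNat (a b : ℕ) (f : Extension → ℝ) :
    ∑ r ∈ Finset.range (weight a b), f (ofNat a b r) =
      a * (a + b + 1) * f row + b * (a + b + 1) * f col + a * b * f both := by
  unfold weight
  rw [Finset.sum_range_add, Finset.sum_range_add]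
  congr 1
  · congr 1
    · rw [Finset.sum_congr rfl (g := fun _ => f row)]
      · simp
      · intro r hr
        simp [ofNat, Finset.mem_range.1 hr]
    · rw [Finset.sum_congr rfl (g := fun _ => f col)]
      · simp
      · intro r hr
        simp [ofNat, Finset.mem_range.1 hr]
  · rw [Finset.sum_congr rfl (g := fun _ => f both)]
    · simp
    · intro r hr
      have h1 : ¬ a * (a + b + 1) + b * (a + b + 1) + r < a * (a + b + 1) := by omega
      have h2 : ¬ a * (a + b + 1) + b * (a + b + 1) + r <
        a * (a + b + 1) + b * (a + b + 1) := by omega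
      simp only [ofNat, if_neg h1, if_neg h2]

theorem subset_rows (t : Extension) (X : Finset (Fin n)) (x : Fin n) : X ⊆ t.rows X x := by
  cases t <;> simp [rows]

theorem subset_cols (t : Extension) (Y : Finset (Fin m)) (y : Fin m) : Y ⊆ t.cols Y y := by
  cases t <;> simp [cols]

/-- Only an inequality, since `x` may lie in `X` or `y` in `Y`. Such a draw is still charged the
full cost. -/
theorem card_mul_card_le (t : Extension) (X : Finset (Fin n)) (Y : Finset (Fin m)) (x : Fin n)
    (y : Fin m) : (t.rows X x).card * (t.cols Y y).card ≤
      X.card * Y.card + t.cost X.card Y.card := by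
  have hx := Finset.card_insert_le x X
  have hy := Finset.card_insert_le y Y
  cases t
  · exact (Nat.mul_le_mul_right _ hx).trans_eq (by simp [cost, cols]; ring)
  · exact (Nat.mul_le_mul_left _ hy).trans_eq (by simp [cost, rows]; ring)
  · exact (Nat.mul_le_mul hx hy).trans_eq (by simp [cost]; ring)

theorem cost_le (t : Extension) (a b : ℕ) : t.cost a b ≤ a + b + 1 := by
  cases t <;> simp [cost] <;> omega

theorem length_newEntries_le (t : Extension) (X : Finset (Fin n)) (Y : Finset (Fin m)) (x : Fin n)
    (y : Fin m) : (QueryAlg.newEntries X (t.rows X x) Y (t.cols Y y)).length ≤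
      t.cost X.card Y.card := by
  have h1 := QueryAlg.length_newEntries_add (t.subset_rows X x) (t.subset_cols Y y)
  have h2 := t.card_mul_card_le X Y x y
  omega

/-- The extension by `x` and `y` is reduced and has full size. -/
def Good (t : Extension) (M : Matrix (Fin n) (Fin m) Bool) (X : Finset (Fin n))
    (Y : Finset (Fin m)) (x : Fin n) (y : Fin m) : Prop :=
  IsReducedOn M (t.rows X x) (t.cols Y y) ∧
    (t.rows X x).card * (t.cols Y y).card = X.card * Y.card + t.cost X.card Y.card

end Extension

/-! ### The growing reduced submatrix and the analysis of its budget -/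

section Tester

variable {n m : ℕ}

open Classical in
/-- The tester for rank at most `d`, with `q` queries left, when it knows the submatrix on
`X ×ˢ Y` of the unknown matrix, as recorded in `K`. -/
noncomputable def runTester (d : ℕ) (s : ℕ∞) (q : ℕ) (X : Finset (Fin (n + 1)))
    (Y : Finset (Fin (m + 1))) (K : Matrix (Fin (n + 1)) (Fin (m + 1)) Bool) :
    QueryAlg (n + 1) (m + 1) :=
  if d < sBinaryRank s (mask K X Y) then .halt false else
  -- `draw k` has `k + 1` outcomes, whence the `- 1`.
  .draw (Extension.weight X.card Y.card - 1) fun r => .draw n fun x => .draw m fun y =>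
    -- Positivity of the cost makes the recursion terminate; it is automatic for nonempty `X` and
    -- `Y`. An extension that exceeds the budget ends the run with acceptance.
    if _ : 0 < (Extension.ofNat X.card Y.card r).cost X.card Y.card ∧
        (Extension.ofNat X.card Y.card r).cost X.card Y.card ≤ q then
      .learn (QueryAlg.newEntries X ((Extension.ofNat X.card Y.card r).rows X x) Y
          ((Extension.ofNat X.card Y.card r).cols Y y)) K fun K' =>
        if IsReducedOn K' ((Extension.ofNat X.card Y.card r).rows X x)
            ((Extension.ofNat X.card Y.card r).cols Y y) then
          runTester d s (q - (Extension.ofNat X.card Y.card r).cost X.card Y.card)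
            ((Extension.ofNat X.card Y.card r).rows X x)
            ((Extension.ofNat X.card Y.card r).cols Y y) K'
        else
          runTester d s (q - (Extension.ofNat X.card Y.card r).cost X.card Y.card) X Y K'
    else .halt true
termination_by q
decreasing_by all_goals omega

theorem queries_runTester_le (d : ℕ) (s : ℕ∞) (M : Matrix (Fin (n + 1)) (Fin (m + 1)) Bool)
    (q : ℕ) (X : Finset (Fin (n + 1))) (Y : Finset (Fin (m + 1)))
    (K : Matrix (Fin (n + 1)) (Fin (m + 1)) Bool) :
    (runTester d s q X Y K).queries M ≤ q := by
  induction q using Nat.strong_induction_on generalizing X Y K with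
  | _ q ih =>
    rw [runTester]
    split_ifs
    · simp [QueryAlg.queries]
    · refine QueryAlg.queries_draw_le fun r => QueryAlg.queries_draw_le fun x =>
        QueryAlg.queries_draw_le fun y => ?_
      generalize Extension.ofNat X.card Y.card r = t
      split_ifs with h
      · have hl := t.length_newEntries_le X Y x y
        rw [QueryAlg.queries_learn]
        split_ifs
        · have := ih (q - t.cost X.card Y.card) (by omega) (t.rows X x) (t.cols Y y)
            (QueryAlg.learned M (QueryAlg.newEntries X (t.rows X x) Y (t.cols Y y)) K)
          omega
        · have := ih (q - t.cost X.card Y.card) (by omega) X Y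
            (QueryAlg.learned M (QueryAlg.newEntries X (t.rows X x) Y (t.cols Y y)) K)
          omega
      · simp [QueryAlg.queries]

/-- Rejection needs a known submatrix of rank above `d`, which a matrix of rank at most `d` does not
contain. -/
theorem acc_runTester_eq_one {d : ℕ} {s : ℕ∞} (hs : 1 ≤ s)
    {M : Matrix (Fin (n + 1)) (Fin (m + 1)) Bool} (hM : sBinaryRank s M ≤ d)
    (q : ℕ) (X : Finset (Fin (n + 1))) (Y : Finset (Fin (m + 1)))
    (K : Matrix (Fin (n + 1)) (Fin (m + 1)) Bool) (hK : ∀ i ∈ X, ∀ j ∈ Y, K i j = M i j) :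
    (runTester d s q X Y K).acc M = 1 := by
  induction q using Nat.strong_induction_on generalizing X Y K with
  | _ q ih =>
    rw [runTester]
    have h0 : ¬ d < sBinaryRank s (mask K X Y) := by
      rw [mask_congr hK, not_lt]
      exact (sBinaryRank_pullback_le hs _ _ _).trans hM
    rw [if_neg h0]
    refine QueryAlg.acc_draw_eq_one fun r => QueryAlg.acc_draw_eq_one fun x =>
        QueryAlg.acc_draw_eq_one fun y => ?_
    generalize Extension.ofNat X.card Y.card r = t
    split_ifs with h
    · have hl := QueryAlg.learned_newEntries (X' := t.rows X x) (Y' := t.cols Y y) hK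
      rw [QueryAlg.acc_learn]
      split_ifs
      · exact ih _ (by omega) _ _ _ hl
      · exact ih _ (by omega) _ _ _ fun i hi j hj =>
          hl i (t.subset_rows X x hi) j (t.subset_cols Y y hj)
    · simp

open Classical in
/-- In a matrix that is far from rank at most `d`, the extensions of a reduced submatrix of rank
at most `d` are good with large total probability. -/
theorem lt_sum_card_good {d : ℕ} {s : ℕ∞} (hs : 1 ≤ s) {ε : ℝ}
    {M : Matrix (Fin n) (Fin m) Bool} (hM : IsFar ε (fun M => sBinaryRank s M ≤ d) M)
    {X : Finset (Fin n)} {Y : Finset (Fin m)} (h : IsReducedOn M X Y)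
    (hd : sBinaryRank s (mask M X Y) ≤ d) :
    ε * ((n : ℝ) * m) <
      ∑ x, ∑ y, ((if Extension.row.Good M X Y x y then (1 : ℝ) else 0) +
        (if Extension.col.Good M X Y x y then 1 else 0) +
        (if Extension.both.Good M X Y x y then 1 else 0)) := by
  obtain ⟨M', hM', hgood⟩ := h.exists_close hs
  refine (hM M' (hM'.trans hd)).trans_le ?_
  rw [Finset.card_filter, Nat.cast_sum, Fintype.sum_prod_type]
  refine Finset.sum_le_sum fun x _ => Finset.sum_le_sum fun y _ => ?_
  have h0 : ∀ p : Prop, (0 : ℝ) ≤ if p then 1 else 0 := fun p => by split_ifs <;> norm_num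
  have h1 := h0 (Extension.row.Good M X Y x y)
  have h2 := h0 (Extension.col.Good M X Y x y)
  have h3 := h0 (Extension.both.Good M X Y x y)
  by_cases hxy : M x y ≠ M' x y
  swap
  · rw [if_neg hxy, Nat.cast_zero]
    positivity
  rw [if_pos hxy, Nat.cast_one]
  rcases hgood x y hxy with ⟨hx, hr⟩ | ⟨hy, hr⟩ | ⟨hx, hy, hr⟩
  · have : Extension.row.Good M X Y x y :=
      ⟨hr, by simp [Extension.rows, Extension.cols, Extension.cost, hx]; ring⟩
    rw [if_pos this]
    linarith
  · have : Extension.col.Good M X Y x y :=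
      ⟨hr, by simp [Extension.rows, Extension.cols, Extension.cost, hy]; ring⟩
    rw [if_pos this]
    linarith
  · have : Extension.both.Good M X Y x y :=
      ⟨hr, by simp [Extension.rows, Extension.cols, Extension.cost, hx, hy]; ring⟩
    rw [if_pos this]
    linarith

/-- Bound on the acceptance probability on a far matrix. The right-hand side is, up to the factor
`B`, a supermartingale: an extension of cost `c` decreases the remaining number of queries `q`
by `c`, and increases the size of the known submatrix by `c` if it is good. -/
theorem acc_runTester_le {d : ℕ} {s : ℕ∞} (hs : 1 ≤ s) {ε : ℝ} (hε : 0 < ε)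
    {M : Matrix (Fin (n + 1)) (Fin (m + 1)) Bool}
    (hM : IsFar ε (fun M => sBinaryRank s M ≤ d) M) (B : ℕ) (q : ℕ) (hq : q ≤ B)
    (X : Finset (Fin (n + 1))) (Y : Finset (Fin (m + 1)))
    (K : Matrix (Fin (n + 1)) (Fin (m + 1)) Bool) (hK : ∀ i ∈ X, ∀ j ∈ Y, K i j = M i j)
    (hX : X.Nonempty) (hY : Y.Nonempty) (hred : IsReducedOn M X Y)
    (hXY : X.card * Y.card ≤ 2 * (binomLE d s * 2 ^ d) + 2) :
    B * (runTester d s q X Y K).acc M ≤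
      3 / ε * ((2 * (binomLE d s * 2 ^ d) + 2 : ℕ) - (X.card * Y.card : ℕ)) + B - q := by
  classical
  induction q using Nat.strong_induction_on generalizing X Y K with
  | _ q ih =>
    rw [runTester]
    set F := binomLE d s * 2 ^ d
    have hL : 0 < 3 / ε := by positivity
    have hqB : (q : ℝ) ≤ B := by exact_mod_cast hq
    split_ifs with h0
    · have : ((X.card * Y.card : ℕ) : ℝ) ≤ (2 * F + 2 : ℕ) := by exact_mod_cast hXY
      rw [QueryAlg.acc_halt_false, mul_zero]
      have := mul_nonneg hL.le (sub_nonneg.2 this)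
      linarith
    rw [mask_congr hK, not_lt] at h0
    have hF : X.card * Y.card ≤ F := hred.card_mul_card_le hs h0
    have ha : 0 < X.card := hX.card_pos
    have hb : 0 < Y.card := hY.card_pos
    set a := X.card with ha_def
    set b := Y.card with hb_def
    -- From `(a - 1) * (b - 1) ≥ 0` and `a * b ≤ F`. Hence one more extension leaves the size at
    -- most `2 * F + 2`, the constant in the potential.
    have hab : a + b + 1 ≤ F + 2 := by nlinarith
    let T : Extension → Fin (n + 1) → Fin (m + 1) → QueryAlg (n + 1) (m + 1) := fun t x y =>
      if h : 0 < t.cost a b ∧ t.cost a b ≤ q then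
        .learn (QueryAlg.newEntries X (t.rows X x) Y (t.cols Y y)) K fun K' =>
          if IsReducedOn K' (t.rows X x) (t.cols Y y) then
            runTester d s (q - t.cost a b) (t.rows X x) (t.cols Y y) K'
          else
            runTester d s (q - t.cost a b) X Y K'
      else .halt true
    set R : ℝ := 3 / ε * ((2 * F + 2 : ℕ) - (a * b : ℕ)) + B - q with hR
    have htrial : ∀ t x y, B * (T t x y).acc M ≤
        R + t.cost a b - 3 / ε * t.cost a b * if t.Good M X Y x y then 1 else 0 := by
      intro t x y
      have hcost := t.cost_le a b
      have hcost0 : 0 < t.cost a b := by cases t <;> simp [Extension.cost] <;> omega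
      have hle : (if t.Good M X Y x y then (1 : ℝ) else 0) ≤ 1 := by split_ifs <;> norm_num
      have hgrow : a * b ≤ (t.rows X x).card * (t.cols Y y).card :=
        Nat.mul_le_mul (Finset.card_le_card (t.subset_rows X x))
          (Finset.card_le_card (t.subset_cols Y y))
      have hmax := t.card_mul_card_le X Y x y
      rw [← ha_def, ← hb_def] at hmax
      have hcL : 0 ≤ 3 / ε * t.cost a b := by positivity
      simp only [T]
      by_cases h : 0 < t.cost a b ∧ t.cost a b ≤ q
      swap
      -- Out of budget: acceptance is certain, so the right side must be at least `B`. It is,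
      -- because `q` is at most the cost and even a full extension keeps the size within `2 * F +
      -- 2`.
      · rw [dif_neg h, QueryAlg.acc_halt_true, mul_one]
        have hqc : (q : ℝ) ≤ t.cost a b := by
          have : q ≤ t.cost a b := by omega
          exact_mod_cast this
        have hG : ((t.cost a b : ℕ) : ℝ) ≤ (2 * F + 2 : ℕ) - (a * b : ℕ) := by
          have : t.cost a b + a * b ≤ 2 * F + 2 := by omega
          rw [le_sub_iff_add_le]
          exact_mod_cast this
        have h1 := mul_le_mul_of_nonneg_left hG hL.le
        have h2 := mul_le_mul_of_nonneg_left hle hcL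
        linarith
      have hl := QueryAlg.learned_newEntries (X' := t.rows X x) (Y' := t.cols Y y) hK
      have hcast : ((q - t.cost a b : ℕ) : ℝ) = q - t.cost a b := by
        rw [Nat.cast_sub h.2]
      rw [dif_pos h, QueryAlg.acc_learn]
      by_cases hg : IsReducedOn M (t.rows X x) (t.cols Y y)
      · rw [if_pos ((isReducedOn_congr hl).2 hg)]
        have := ih (q - t.cost a b) (by omega) (by omega) (t.rows X x) (t.cols Y y) _ hl
          (hX.mono (t.subset_rows X x)) (hY.mono (t.subset_cols Y y)) hg (by omega)
        rw [hcast] at this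
        refine this.trans ?_
        by_cases hgood : t.Good M X Y x y
        · rw [if_pos hgood, hgood.2, ← ha_def, ← hb_def, hR]
          push_cast
          exact le_of_eq (by ring)
        · rw [if_neg hgood]
          have h1 : ((a * b : ℕ) : ℝ) ≤ ((t.rows X x).card * (t.cols Y y).card : ℕ) := by
            exact_mod_cast hgrow
          have h2 := mul_le_mul_of_nonneg_left h1 hL.le
          rw [hR]
          linarith
      · rw [if_neg (fun h' => hg ((isReducedOn_congr hl).1 h')), if_neg fun h' => hg h'.1]
        have := ih (q - t.cost a b) (by omega) (by omega) X Y
          (QueryAlg.learned M (QueryAlg.newEntries X (t.rows X x) Y (t.cols Y y)) K)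
          (fun i hi j hj => hl i (t.subset_rows X x hi) j (t.subset_cols Y y hj)) hX hY hred hXY
        rw [hcast] at this
        rw [hR]
        linarith
    let g : Extension → ℝ := fun t => ∑ x, ∑ y, if t.Good M X Y x y then (1 : ℝ) else 0
    have hfar := lt_sum_card_good hs hM hred h0
    simp only [Finset.sum_add_distrib] at hfar
    -- The `3` matches the three equal expected costs; this fixes the factor `3 / ε` in the
    -- potential.
    have hfar' : 3 * (((n + 1 : ℕ) : ℝ) * (m + 1 : ℕ)) ≤
        3 / ε * (g .row + g .col + g .both) := by
      rw [div_mul_eq_mul_div, le_div_iff₀ hε]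
      linarith
    have hsum : ∀ t, ∑ x, ∑ y, B * (T t x y).acc M ≤
        (((n + 1 : ℕ) : ℝ) * (m + 1 : ℕ)) * (R + t.cost a b) - 3 / ε * t.cost a b * g t := by
      intro t
      refine (Finset.sum_le_sum fun x _ => Finset.sum_le_sum fun y _ => htrial t x y).trans_eq ?_
      simp only [Finset.sum_sub_distrib, ← Finset.mul_sum, Finset.sum_const, Finset.card_univ,
        Fintype.card_fin, nsmul_eq_mul, g]
      ring
    have hW : 0 < Extension.weight a b := by
      unfold Extension.weight
      positivity
    have hW1 : Extension.weight a b - 1 + 1 = Extension.weight a b := by omega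
    have hW2 : ((Extension.weight a b - 1 : ℕ) : ℝ) + 1 = Extension.weight a b := by
      exact_mod_cast hW1
    have hacc : B * (QueryAlg.draw (Extension.weight a b - 1) fun r => .draw n fun x =>
        .draw m fun y => T (Extension.ofNat a b r) x y).acc M =
        (∑ r ∈ Finset.range (Extension.weight a b),
          ∑ x, ∑ y, B * (T (Extension.ofNat a b r) x y).acc M) /
        (Extension.weight a b * (((n + 1 : ℕ) : ℝ) * (m + 1 : ℕ))) := by
      simp only [QueryAlg.acc_draw, hW2]
      rw [Fin.sum_univ_eq_sum_range (fun r => (∑ x : Fin (n + 1),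
        (∑ y, (T (Extension.ofNat a b r) x y).acc M) / ((m : ℝ) + 1)) / ((n : ℝ) + 1)), hW1]
      simp only [← Finset.sum_div, ← Finset.mul_sum, div_div]
      push_cast
      rw [mul_div_assoc]
      congr 2
      ring
    refine hacc.trans_le ?_
    rw [div_le_iff₀ (by positivity)]
    refine (Finset.sum_le_sum fun r _ => hsum (Extension.ofNat a b r)).trans ?_
    rw [Extension.sum_ofNat a b fun t =>
      (((n + 1 : ℕ) : ℝ) * (m + 1 : ℕ)) * (R + t.cost a b) - 3 / ε * t.cost a b * g t]
    -- The common value of weight times cost. Multiplied by it, `hfar'` says that the expected gain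
    -- pays for the expected cost.
    have hV : (0 : ℝ) ≤ a * b * (a + b + 1) := by positivity
    have := mul_le_mul_of_nonneg_left hfar' hV
    simp only [Extension.cost, Extension.weight]
    push_cast at this ⊢
    linarith

end Tester

/-! ### The testers with their query bounds -/

section Testers

variable {n m : ℕ}

theorem binomLE_pos (d : ℕ) (s : ℕ∞) : 0 < binomLE d s := by
  rw [← card_filter_card_le]
  exact Finset.card_pos.2 ⟨∅, by simp⟩

theorem one_le_binomLE_mul_pow (d : ℕ) (s : ℕ∞) : (1 : ℝ) ≤ (binomLE d s : ℝ) * 2 ^ d := by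
  have : 1 ≤ binomLE d s * 2 ^ d := Nat.mul_pos (binomLE_pos d s) (by positivity)
  exact_mod_cast this

/-- A matrix with the property is not far from it. -/
theorem IsFar.not_self {ε : ℝ} (hε : 0 < ε) {P : Matrix (Fin n) (Fin m) Bool → Prop}
    {M : Matrix (Fin n) (Fin m) Bool} (h : IsFar ε P M) : ¬ P M := by
  intro hP
  have := h M hP
  simp only [ne_eq, not_true_eq_false, Finset.filter_false, Finset.card_empty,
    Nat.cast_zero] at this
  exact absurd this (not_lt.2 (by positivity))

/-- The tester for rank at most `d`. -/
noncomputable def atMostTester (d : ℕ) (s : ℕ∞) (ε : ℝ) : (n m : ℕ) → QueryAlg n m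
  | _ + 1, _ + 1 => .query 0 0 fun b =>
      runTester d s ⌈27 * ((binomLE d s : ℝ) * 2 ^ d) / ε⌉₊ {0} {0} fun _ _ => b
  | 0, _ => .halt true
  | _ + 1, 0 => .halt true

theorem isOneSidedTester_halt_true {d : ℕ} {s : ℕ∞} (hs : 1 ≤ s) {ε : ℝ} (hε : 0 < ε)
    (hnm : n = 0 ∨ m = 0) :
    IsOneSidedTester ε (fun M : Matrix (Fin n) (Fin m) Bool => sBinaryRank s M ≤ d)
      (.halt true) := by
  refine ⟨fun M _ => QueryAlg.verdict_true_eq_one_of_acc (by simp), fun M hM =>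
    absurd ?_ (hM.not_self hε)⟩
  have h1 := sBinaryRank_le_rows hs M
  have h2 := sBinaryRank_le_cols hs M
  omega

theorem isOneSidedTester_atMostTester {d : ℕ} {s : ℕ∞} (hs : 1 ≤ s) {ε : ℝ} (hε : 0 < ε)
    (n m : ℕ) :
    IsOneSidedTester ε (fun M => sBinaryRank s M ≤ d) (atMostTester d s ε n m) := by
  rcases n with _ | n
  · exact isOneSidedTester_halt_true hs hε (Or.inl rfl)
  rcases m with _ | m
  · exact isOneSidedTester_halt_true hs hε (Or.inr rfl)
  have hK : ∀ M : Matrix (Fin (n + 1)) (Fin (m + 1)) Bool,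
      ∀ i ∈ ({0} : Finset (Fin (n + 1))), ∀ j ∈ ({0} : Finset (Fin (m + 1))),
        M 0 0 = M i j := by
    intro M i hi j hj
    rw [Finset.mem_singleton.1 hi, Finset.mem_singleton.1 hj]
  have hF := one_le_binomLE_mul_pow d s
  refine ⟨fun M hM => QueryAlg.verdict_true_eq_one_of_acc ?_,
    fun M hM => QueryAlg.verdict_false_ge_of_acc ?_⟩
  · rw [atMostTester, QueryAlg.acc_query]
    exact acc_runTester_eq_one hs hM _ _ _ _ (hK M)
  · rw [atMostTester, QueryAlg.acc_query]
    set B := ⌈27 * ((binomLE d s : ℝ) * 2 ^ d) / ε⌉₊ with hB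
    have h := acc_runTester_le hs hε hM B B le_rfl {0} {0} (fun _ _ => M 0 0) (hK M)
      (by simp) (by simp) (isReducedOn_singleton M 0 0) (by simp)
    have hB1 : 27 * ((binomLE d s : ℝ) * 2 ^ d) / ε ≤ B := Nat.le_ceil _
    have hB0 : (0 : ℝ) < B := lt_of_lt_of_le (by positivity) hB1
    simp only [Finset.card_singleton] at h
    push_cast at h
    -- At size `1` with full budget the potential is `3 * (2 * F + 1) / ε ≤ 9 * F / ε`, one third of
    -- `27 * F / ε`.
    have h3 : 3 / ε * (2 * ((binomLE d s : ℝ) * 2 ^ d) + 2 - 1 * 1) ≤ B * (1 / 3) := by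
      refine le_trans ?_ (mul_le_mul_of_nonneg_right hB1 (by norm_num))
      rw [div_mul_eq_mul_div, div_mul_eq_mul_div]
      refine div_le_div_of_nonneg_right ?_ hε.le
      linarith
    exact le_of_mul_le_mul_left (by linarith) hB0

theorem queries_atMostTester_le (d : ℕ) (s : ℕ∞) {ε : ℝ} (hε : 0 < ε) (hε1 : ε < 1)
    (M : Matrix (Fin n) (Fin m) Bool) :
    ((atMostTester d s ε n m).queries M : ℝ) ≤ 29 * ((binomLE d s : ℝ) * 2 ^ d / ε) := by
  have hF := one_le_binomLE_mul_pow d s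
  -- Absorbs two units, the rounding up and the initial query: `27 + 2 = 29`.
  have hF' : 1 ≤ (binomLE d s : ℝ) * 2 ^ d / ε := by
    rw [le_div_iff₀ hε]
    linarith
  rcases n with _ | n
  · simp only [atMostTester, QueryAlg.queries, Nat.cast_zero]
    positivity
  rcases m with _ | m
  · simp only [atMostTester, QueryAlg.queries, Nat.cast_zero]
    positivity
  rw [atMostTester, QueryAlg.queries]
  have h1 := queries_runTester_le d s M ⌈27 * ((binomLE d s : ℝ) * 2 ^ d) / ε⌉₊ {0} {0}
    fun _ _ => M 0 0
  have h2 := Nat.ceil_lt_add_one (a := 27 * ((binomLE d s : ℝ) * 2 ^ d) / ε) (by positivity)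
  have h3 : ((runTester d s ⌈27 * ((binomLE d s : ℝ) * 2 ^ d) / ε⌉₊ {0} {0}
    fun _ _ => M 0 0).queries M : ℝ) ≤ ⌈27 * ((binomLE d s : ℝ) * 2 ^ d) / ε⌉₊ := by
    exact_mod_cast h1
  rw [mul_div_assoc] at h2 h3
  push_cast
  rw [mul_div_assoc]
  linarith

/-! ### Rank exactly `d` -/

open Classical in
/-- The algorithm that reads the whole matrix and accepts if it has the property `P`. -/
noncomputable def readAll (P : Matrix (Fin n) (Fin m) Bool → Prop) : QueryAlg n m :=
  .learn (Finset.univ : Finset (Fin n × Fin m)).toList (Matrix.of fun _ _ => false) fun K =>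
    .halt (decide (P K))

theorem acc_readAll (P : Matrix (Fin n) (Fin m) Bool → Prop) (M : Matrix (Fin n) (Fin m) Bool) :
    open Classical in (readAll P).acc M = if P M then 1 else 0 := by
  classical
  have : QueryAlg.learned M (Finset.univ : Finset (Fin n × Fin m)).toList (Matrix.of fun _ _ => false)
      = M := by
    funext i j
    simp [QueryAlg.learned]
  rw [readAll, QueryAlg.acc_learn, this]
  by_cases h : P M <;> simp [h]

theorem isOneSidedTester_readAll {ε : ℝ} (hε : 0 < ε)
    (P : Matrix (Fin n) (Fin m) Bool → Prop) : IsOneSidedTester ε P (readAll P) := by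
  refine ⟨fun M hM => QueryAlg.verdict_true_eq_one_of_acc ?_,
    fun M hM => QueryAlg.verdict_false_ge_of_acc ?_⟩
  · rw [acc_readAll, if_pos hM]
  · rw [acc_readAll, if_neg (hM.not_self hε)]
    norm_num

theorem queries_readAll (P : Matrix (Fin n) (Fin m) Bool → Prop)
    (M : Matrix (Fin n) (Fin m) Bool) : (readAll P).queries M = n * m := by
  rw [readAll, QueryAlg.queries_learn]
  simp [QueryAlg.queries]

open Classical in
/-- The tester for rank exactly `d`. If `n * m` is large compared with `d ^ 2 / ε`, then every
matrix of rank at most `d` is close to one of rank exactly `d`. -/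
noncomputable def exactTester (d : ℕ) (s : ℕ∞) (ε : ℝ) (n m : ℕ) : QueryAlg n m :=
  if n < d ∨ m < d then .halt false
  else if ε * ((n : ℝ) * m) < 2 * (d : ℝ) ^ 2 then readAll fun M => sBinaryRank s M = d
  else atMostTester d s (ε / 2) n m

/-- Triangle inequality: the `d ^ 2` changes that make the rank exactly `d` use up at most half of
the allowance `ε * n * m`. -/
theorem IsFar.of_exact {d : ℕ} {s : ℕ∞} (hs : 1 ≤ s) {ε : ℝ} (hn : d ≤ n) (hm : d ≤ m)
    (hd : 2 * (d : ℝ) ^ 2 ≤ ε * ((n : ℝ) * m)) {M : Matrix (Fin n) (Fin m) Bool}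
    (h : IsFar ε (fun M => sBinaryRank s M = d) M) :
    IsFar (ε / 2) (fun M => sBinaryRank s M ≤ d) M := by
  intro M' hM'
  obtain ⟨M'', hM'', hcard⟩ := exists_sBinaryRank_eq hs hn hm hM'
  have h1 := h M'' hM''
  have h2 : (Finset.univ.filter fun p : Fin n × Fin m => M p.1 p.2 ≠ M'' p.1 p.2).card ≤
      (Finset.univ.filter fun p : Fin n × Fin m => M p.1 p.2 ≠ M' p.1 p.2).card + d ^ 2 := by
    refine le_trans (le_trans (Finset.card_le_card ?_) (Finset.card_union_le _ _))
      (Nat.add_le_add_left hcard _)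
    intro p hp
    simp only [Finset.mem_union, Finset.mem_filter, Finset.mem_univ, true_and] at hp ⊢
    by_contra! hcon
    exact hp (hcon.1.trans hcon.2)
  have h3 : ((Finset.univ.filter fun p : Fin n × Fin m => M p.1 p.2 ≠ M'' p.1 p.2).card : ℝ) ≤
      (Finset.univ.filter fun p : Fin n × Fin m => M p.1 p.2 ≠ M' p.1 p.2).card + (d : ℝ) ^ 2 := by
    exact_mod_cast h2
  linarith

theorem isOneSidedTester_exactTester {d : ℕ} {s : ℕ∞} (hs : 1 ≤ s) {ε : ℝ} (hε : 0 < ε)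
    (n m : ℕ) :
    IsOneSidedTester ε (fun M => sBinaryRank s M = d) (exactTester d s ε n m) := by
  unfold exactTester
  split_ifs with h1 h2
  · refine ⟨fun M hM => ?_, fun M _ => QueryAlg.verdict_false_ge_of_acc (by simp)⟩
    have h3 := sBinaryRank_le_rows hs M
    have h4 := sBinaryRank_le_cols hs M
    omega
  · exact isOneSidedTester_readAll hε _
  · have h := isOneSidedTester_atMostTester (d := d) hs (half_pos hε) n m
    rw [not_or, not_lt, not_lt] at h1
    exact ⟨fun M hM => h.1 M hM.le,
      fun M hM => h.2 M (hM.of_exact hs h1.1 h1.2 (not_lt.1 h2))⟩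

/-- Reading everything costs `n * m < 2 * d ^ 2 / ε`, which this brings below a multiple of `2 ^ d /
ε`. -/
theorem sq_le_two_mul_two_pow (d : ℕ) : d ^ 2 ≤ 2 * 2 ^ d := by
  rcases Nat.lt_or_ge d 4 with h | h
  · interval_cases d <;> norm_num
  · have : d ^ 2 ≤ 2 ^ d := by
      induction d, h using Nat.le_induction with
      | base => norm_num
      | succ d hd ih => rw [pow_succ 2]; nlinarith
    omega

theorem queries_exactTester_le (d : ℕ) (s : ℕ∞) {ε : ℝ} (hε : 0 < ε) (hε1 : ε < 1)
    (M : Matrix (Fin n) (Fin m) Bool) :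
    ((exactTester d s ε n m).queries M : ℝ) ≤ 58 * ((binomLE d s : ℝ) * 2 ^ d / ε) := by
  unfold exactTester
  split_ifs with h1 h2
  · simp only [QueryAlg.queries, Nat.cast_zero]
    positivity
  · rw [queries_readAll, mul_div_assoc', le_div_iff₀ hε]
    have h3 : ((d : ℝ)) ^ 2 ≤ 2 * 2 ^ d := by exact_mod_cast sq_le_two_mul_two_pow d
    have h4 : (1 : ℝ) ≤ binomLE d s := by exact_mod_cast binomLE_pos d s
    have h5 : (1 : ℝ) * 2 ^ d ≤ binomLE d s * 2 ^ d := by gcongr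
    push_cast
    have h6 : (0 : ℝ) < 2 ^ d := by positivity
    linarith
  · refine (queries_atMostTester_le d s (half_pos hε) (by linarith) M).trans_eq ?_
    field_simp
    ring

end Testers

theorem theorem1 :
    ∃ (C : ℝ) (k : ℕ), 0 < C ∧
      ∃ (atMost exact : (d : ℕ) → (s : ℕ∞) → (ε : ℝ) → (n m : ℕ) → QueryAlg n m),
        ∀ (d : ℕ) (s : ℕ∞) (ε : ℝ) (n m : ℕ), 1 ≤ s → 0 < ε → ε < 1 →
          (IsOneSidedTester ε (fun M => sBinaryRank s M ≤ d) (atMost d s ε n m) ∧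
            ∀ M : Matrix (Fin n) (Fin m) Bool,
              ((atMost d s ε n m).queries M : ℝ) ≤
                C * ((binomLE d s : ℝ) * 2 ^ d / ε) *
                  (1 + Real.log ((binomLE d s : ℝ) * 2 ^ d / ε)) ^ k) ∧
          (IsOneSidedTester ε (fun M => sBinaryRank s M = d) (exact d s ε n m) ∧
            ∀ M : Matrix (Fin n) (Fin m) Bool,
              ((exact d s ε n m).queries M : ℝ) ≤
                C * ((binomLE d s : ℝ) * 2 ^ d / ε) *
                  (1 + Real.log ((binomLE d s : ℝ) * 2 ^ d / ε)) ^ k) := by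
  -- `58 = 2 * 29`, as the exact tester runs the other one with `ε / 2`; the exponent `0` means that
  -- no logarithmic factor occurs.
  refine ⟨58, 0, by norm_num, atMostTester, exactTester, fun d s ε n m hs hε hε1 =>
    ⟨⟨isOneSidedTester_atMostTester hs hε n m, fun M => ?_⟩,
      ⟨isOneSidedTester_exactTester hs hε n m, fun M => ?_⟩⟩⟩
  · rw [pow_zero, mul_one]
    refine (queries_atMostTester_le d s hε hε1 M).trans ?_
    gcongr
    norm_num
  · rw [pow_zero, mul_one]
    exact queries_exactTester_le d s hε hε1 M
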